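/- Let $1\le k\le n$, $L>0$, $\theta\in(0,1)$, and let $f:\mathbb R^n\to\mathbb R$ be bounded below and $L$-smooth (continuously differentiable with $\|\nabla f(x)-\nabla f(y)\|\le L\|x-y\|$ for all $x,y$, where $\|\cdot\|$ is the Euclidean norm). Assume that $f$ is a Łojasiewicz function with exponent $\theta$: for every $x^*$ with $\nabla f(x^*)=0$ there are constants $\kappa,\mu>0$ such that $|f(x)-f(x^*)|^\theta\le\kappa\|\nabla f(x)\|$ whenever $\|x-x^*\|\le\mu$. Let $x_0\in\mathbb R^n$, $\eta>0$, $\delta_0\in(0,1]$ and $\delta_t=\delta_0 2^{-t}$. Let $V_0,V_1,\dots$ be independent random matrices, each uniformly distributed on the Stiefel manifold $\mathrm{St}(n,k)=\{V\in\mathbb R^{n\times k}:V^\top V=I_k\}$, let $v_{t,1},\dots,v_{t,k}$ be the columns of $V_t$, and let $(x_t)$ be the iterates of stochastic zeroth-order gradient descent (SZGD), $$x_{t+1}=x_t-\eta\,\frac{n}{2\delta_t k}\sum_{i=1}^k\bigl(f(x_t+\delta_t v_{t,i})-f(x_t-\delta_t v_{t,i})\bigr)v_{t,i},\qquad t=0,1,2,\dots$$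 Assume that $(x_t)$ is bounded almost surely. Then: (a) Suppose $\theta\in(0,\tfrac12]$ and $-1\le\frac{Ln\eta^2}{2k}-\eta<0$. If $\kappa$ can be chosen independently of $x^*$ (for example, if $\kappa=1$ for every critical point), then there is a deterministic constant $Q>1$ such that, almost surely, $\sum_{s\ge0}\|x_{s+1}-x_s\|^2<\infty$ and $Q^t\sum_{s=t}^\infty\|x_{s+1}-x_s\|^2\to0$ as $t\to\infty$. If $\kappa$ is allowed to depend on $x^*$, the same holds with a $Q>1$ that may depend on the realization. (b) Suppose $\theta\in(\tfrac12,1)$ and $\eta\in(0,\frac{2k}{Ln})$. Then, almost surely, $\sum_{s\ge0}\|x_{s+1}-x_s\|^2<\infty$ and $\sum_{s=t}^\infty\|x_{s+1}-x_s\|^2$ tends to $0$ at rate $O\bigl(t^{1/(1-2\theta)}\bigr)$ as $t\to\infty$. -/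

import Mathlib

open MeasureTheory ProbabilityTheory Filter Topology Asymptotics

noncomputable section

namespace SZGD

/-- `f` is `L`-smooth: continuously differentiable with `L`-Lipschitz gradient. -/
def IsLSmooth {n : ℕ} (f : EuclideanSpace ℝ (Fin n) → ℝ) (L : ℝ) : Prop :=
  ContDiff ℝ 1 f ∧ ∀ x y, ‖gradient f x - gradient f y‖ ≤ L * ‖x - y‖

/-- The Łojasiewicz inequality with exponent `θ` and constants `κ`, `μ` around the point `p`. -/
def LojasiewiczIneq {n : ℕ} (f : EuclideanSpace ℝ (Fin n) → ℝ) (θ κ μ : ℝ)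
    (p : EuclideanSpace ℝ (Fin n)) : Prop :=
  ∀ x, ‖x - p‖ ≤ μ → |f x - f p| ^ θ ≤ κ * ‖gradient f x‖

/-- Łojasiewicz function with exponent `θ`: both constants may depend on the critical point. -/
def IsLojasiewicz {n : ℕ} (f : EuclideanSpace ℝ (Fin n) → ℝ) (θ : ℝ) : Prop :=
  Differentiable ℝ f ∧
    ∀ p, gradient f p = 0 → ∃ κ > 0, ∃ μ > 0, LojasiewiczIneq f θ κ μ p

/-- Łojasiewicz function with exponent `θ` and one multiplicative constant `κ` for all critical
points (the normalisation `κ = 1` is a special case); the radius may depend on the point. -/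
def IsLojasiewiczWith {n : ℕ} (f : EuclideanSpace ℝ (Fin n) → ℝ) (θ κ : ℝ) : Prop :=
  Differentiable ℝ f ∧ ∀ p, gradient f p = 0 → ∃ μ > 0, LojasiewiczIneq f θ κ μ p

/-- The Stiefel manifold `St(n, k)`, a matrix `V` with `Vᵀ V = I` being given by its columns. -/
def stiefel (n k : ℕ) : Set (Fin k → EuclideanSpace ℝ (Fin n)) :=
  {v | Orthonormal ℝ v}

/-- `ν` is the uniform distribution on `St(n, k)`: the (unique) probability measure carried by
`St(n, k)` that is invariant under the transitive action of the orthogonal group `O(n)`. -/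
def IsUniformStiefel {n k : ℕ} (ν : Measure (Fin k → EuclideanSpace ℝ (Fin n))) : Prop :=
  IsProbabilityMeasure ν ∧ (∀ᵐ v ∂ν, v ∈ stiefel n k) ∧
    ∀ U : EuclideanSpace ℝ (Fin n) ≃ₗᵢ[ℝ] EuclideanSpace ℝ (Fin n),
      ν.map (fun v i => U (v i)) = ν

/-- The two-point gradient estimator at `x` with directions `v` and granularity `δ`. -/
def gradEst {n k : ℕ} (f : EuclideanSpace ℝ (Fin n) → ℝ) (δ : ℝ)
    (v : Fin k → EuclideanSpace ℝ (Fin n)) (x : EuclideanSpace ℝ (Fin n)) :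
    EuclideanSpace ℝ (Fin n) :=
  ((n : ℝ) / (2 * δ * k)) • ∑ i, (f (x + δ • v i) - f (x - δ • v i)) • v i

/-- The iterates of stochastic zeroth-order gradient descent with constant step size `η`, starting
point `x₀`, granularities `δ₀ / 2 ^ t` and sampled frames `v t`. -/
def iter {n k : ℕ} (f : EuclideanSpace ℝ (Fin n) → ℝ) (η δ₀ : ℝ)
    (x₀ : EuclideanSpace ℝ (Fin n)) (v : ℕ → Fin k → EuclideanSpace ℝ (Fin n)) :
    ℕ → EuclideanSpace ℝ (Fin n)
  | 0 => x₀
  | t + 1 => iter f η δ₀ x₀ v t - η • gradEst f (δ₀ / 2 ^ t) (v t) (iter f η δ₀ x₀ v t)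

/-- The squared increment `‖x_{s+1} - x_s‖²`. -/
def sqStep {n : ℕ} (x : ℕ → EuclideanSpace ℝ (Fin n)) (s : ℕ) : ℝ :=
  ‖x (s + 1) - x s‖ ^ 2

/-- The tail sum `∑_{s ≥ t} ‖x_{s+1} - x_s‖²` (meaningful when the increments are
square-summable). -/
def tailSum {n : ℕ} (x : ℕ → EuclideanSpace ℝ (Fin n)) (t : ℕ) : ℝ :=
  ∑' s, sqStep x (t + s)

end SZGD

end

namespace SZGD

/-! ### Counting successes of adapted trials -/

/-! Apart from almost sure orthonormality of the frames, randomness enters only through a count.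
Along any sequence of orthonormal frames the descent lemma bounds `f (x (t + 1))` plus a multiple of
`⟪v_i, ∇f⟫² + ‖x (t + 1) - x t‖²` by `f (x t) + D δ_t²` (`IsLSmooth.exists_descent_step`). As `δ_t²`
is geometric, a multiple of it added to `f (x t) - l`, with `l` the limit of the values, gives a
decreasing `G → 0` that dominates the tail sum up to a constant.

Call a time informative if one fixed column sees at least `1/n` of the squared gradient. At such
times the drop of `G` controls the gradient, so the gradient tends to zero along them; compactness
then gives one Łojasiewicz constant valid eventually, and `G (t + 1) ≤ G t - C * G t ^ m` for `m ≥
max 1 (2θ)` (`exists_lyapunov_decrease`). For `m = 1` this is a contraction; for `m = 2θ > 1` it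
makes `G ^ (1 - 2θ)` gain a constant.

By rotation invariance a time is informative with conditional probability at least `1/n`, so
informative times almost surely have positive lower density (`exists_ae_eventually_mul_le_count`).
At other times `G` does not increase, hence the rates in `t`. -/

/-- The information carried by `V 0, …, V (t - 1)`. -/
abbrev past {Ω S : Type*} [MeasurableSpace S] (V : ℕ → Ω → S) (t : ℕ) : MeasurableSpace Ω :=
  ⨆ s ∈ Set.Iio t, MeasurableSpace.comap (V s) inferInstance

section Counting

variable {Ω S E : Type*} [MeasurableSpace S]

theorem past_mono (V : ℕ → Ω → S) {s t : ℕ} (h : s ≤ t) : past V s ≤ past V t :=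
  biSup_mono fun _ hi => lt_of_lt_of_le hi h

theorem measurable_past_succ (V : ℕ → Ω → S) (t : ℕ) : Measurable[past V (t + 1)] (V t) := by
  rw [measurable_iff_comap_le]
  exact le_biSup (fun s => MeasurableSpace.comap (V s) inferInstance) (Nat.lt_succ_self t)

variable [MeasurableSpace Ω] [MeasurableSpace E]

theorem past_le {V : ℕ → Ω → S} (hV : ∀ t, Measurable (V t)) (t : ℕ) :
    past V t ≤ ‹MeasurableSpace Ω› :=
  iSup₂_le fun s _ => (hV s).comap_le

theorem indepFun_of_measurable_past {P : Measure Ω} {V : ℕ → Ω → S}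
    (hV : ∀ t, Measurable (V t)) (hind : iIndepFun V P) {t : ℕ} {Z : Ω → E}
    (hZ : Measurable[past V t] Z) : IndepFun Z (V t) P := by
  have h := indep_iSup_of_disjoint (fun i => (hV i).comap_le) hind.iIndep
    (S := Set.Iio t) (T := {t}) (by simp)
  rw [IndepFun_iff_Indep]
  refine indep_of_indep_of_le_right (indep_of_indep_of_le_left h ?_) ?_
  · exact hZ.comap_le
  · exact le_biSup (fun s => MeasurableSpace.comap (V s) inferInstance) rfl

/-- An exponential moment bound for the number of successes. Given the past, a trial contributes a
factor 1/2 with probability at least `p` and 1 otherwise, hence at most `1 - p / 2` on average.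
Measurability with respect to the past is carried in the induction because independence from the
next trial needs it. -/
theorem lintegral_half_pow_count_le {P : Measure Ω} [IsProbabilityMeasure P] {V : ℕ → Ω → S}
    (hV : ∀ t, Measurable (V t)) (hind : iIndepFun V P) {Z : ℕ → Ω → E}
    (hZ : ∀ t, Measurable[past V t] (Z t)) {A : Set (E × S)} (hA : MeasurableSet A)
    [∀ x, Decidable (x ∈ A)] {p : ENNReal}
    (hp : ∀ t z, p ≤ P.map (V t) {v | (z, v) ∈ A}) (t : ℕ) :
    Measurable[past V t] (fun ω => (2⁻¹ : ENNReal) ^ Nat.count (fun s => (Z s ω, V s ω) ∈ A) t) ∧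
    ∫⁻ ω, (2⁻¹ : ENNReal) ^ Nat.count (fun s => (Z s ω, V s ω) ∈ A) t ∂P ≤ (1 - p / 2) ^ t := by
  classical
  induction t with
  | zero => simp
  | succ t ih =>
    obtain ⟨hm, hi⟩ := ih
    set h : E × S → ENNReal := fun y => if y ∈ A then 2⁻¹ else 1 with hh
    have hhm : Measurable h := Measurable.ite hA measurable_const measurable_const
    have hstep : ∀ ω, (2⁻¹ : ENNReal) ^ Nat.count (fun s => (Z s ω, V s ω) ∈ A) (t + 1) =
        (2⁻¹ : ENNReal) ^ Nat.count (fun s => (Z s ω, V s ω) ∈ A) t * h (Z t ω, V t ω) := by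
      intro ω
      rw [Nat.count_succ, pow_add]
      by_cases hmem : (Z t ω, V t ω) ∈ A <;> simp [hh, hmem]
    simp_rw [hstep]
    constructor
    · have hVt := measurable_past_succ V t
      have hle := past_mono V (Nat.le_succ t)
      exact (hm.mono hle le_rfl).mul (hhm.comp (((hZ t).mono hle le_rfl).prodMk hVt))
    · set W : Ω → ENNReal := fun ω => (2⁻¹ : ENNReal) ^ Nat.count (fun s => (Z s ω, V s ω) ∈ A) t
      have hWm : Measurable W := hm.mono (past_le hV t) le_rfl
      have hZm : Measurable (Z t) := (hZ t).mono (past_le hV t) le_rfl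
      have hpair : IndepFun (fun ω => (W ω, Z t ω)) (V t) P :=
        indepFun_of_measurable_past hV hind (hm.prodMk (hZ t))
      have hlaw := (indepFun_iff_map_prod_eq_prod_map_map
        (hWm.prodMk hZm).aemeasurable (hV t).aemeasurable).1 hpair
      have : IsProbabilityMeasure (P.map (V t)) :=
        Measure.isProbabilityMeasure_map (hV t).aemeasurable
      have hslice : ∀ z, ∫⁻ v, h (z, v) ∂(P.map (V t)) ≤ 1 - p / 2 := by
        intro z
        have hAz : MeasurableSet {v | (z, v) ∈ A} := measurable_prodMk_left hA
        have hsum : ∫⁻ v, h (z, v) ∂(P.map (V t)) + 2⁻¹ * P.map (V t) {v | (z, v) ∈ A} = 1 := by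
          rw [← lintegral_indicator_const hAz, ← lintegral_add_left (by fun_prop)]
          have : ∀ v, h (z, v) + {v | (z, v) ∈ A}.indicator (fun _ => (2⁻¹ : ENNReal)) v = 1 := by
            intro v
            by_cases hv : (z, v) ∈ A <;> simp [hh, hv, ENNReal.inv_two_add_inv_two]
          simp [this]
        have hfin : 2⁻¹ * P.map (V t) {v | (z, v) ∈ A} ≠ ⊤ := by finiteness
        rw [ENNReal.eq_sub_of_add_eq hfin hsum]
        refine tsub_le_tsub_left ?_ 1
        rw [div_eq_mul_inv, mul_comm]
        gcongr
        exact hp t z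
      have hgm : Measurable (fun y : (ENNReal × E) × S => y.1.1 * h (y.1.2, y.2)) := by fun_prop
      calc ∫⁻ ω, W ω * h (Z t ω, V t ω) ∂P
          = ∫⁻ y, y.1.1 * h (y.1.2, y.2) ∂(P.map fun ω => ((W ω, Z t ω), V t ω)) := by
            rw [lintegral_map hgm ((hWm.prodMk hZm).prodMk (hV t))]
        _ = ∫⁻ y, ∫⁻ v, y.1 * h (y.2, v) ∂(P.map (V t)) ∂(P.map fun ω => (W ω, Z t ω)) := by
            rw [hlaw, lintegral_prod _ hgm.aemeasurable]
        _ ≤ ∫⁻ y, y.1 * (1 - p / 2) ∂(P.map fun ω => (W ω, Z t ω)) := by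
            refine lintegral_mono fun y => ?_
            rw [lintegral_const_mul _ (by fun_prop)]
            gcongr
            exact hslice y.2
        _ = (∫⁻ ω, W ω ∂P) * (1 - p / 2) := by
            rw [lintegral_map (by fun_prop) (hWm.prodMk hZm), lintegral_mul_const _ hWm]
        _ ≤ (1 - p / 2) ^ t * (1 - p / 2) := by gcongr
        _ = (1 - p / 2) ^ (t + 1) := (pow_succ _ _).symm

/-- Adapted trials, each with conditional success probability at least `p > 0`, almost surely
succeed with positive lower density. -/
theorem exists_ae_eventually_mul_le_count {P : Measure Ω} [IsProbabilityMeasure P] {V : ℕ → Ω → S}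
    (hV : ∀ t, Measurable (V t)) (hind : iIndepFun V P) {Z : ℕ → Ω → E}
    (hZ : ∀ t, Measurable[past V t] (Z t)) {A : Set (E × S)} (hA : MeasurableSet A)
    [∀ x, Decidable (x ∈ A)] {p : ℝ} (hp0 : 0 < p) (hp1 : p ≤ 1)
    (hp : ∀ t z, ENNReal.ofReal p ≤ P.map (V t) {v | (z, v) ∈ A}) :
    ∃ α > (0 : ℝ), ∀ᵐ ω ∂P, ∀ᶠ t : ℕ in atTop,
      α * t ≤ Nat.count (fun s => (Z s ω, V s ω) ∈ A) t := by
  have hr0 : 0 < 1 - p / 2 := by linarith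
  have hr1 : 1 - p / 2 < 1 := by linarith
  -- The moment decays like `b ^ (2 * t)`: one factor `b ^ t` pays for the weight `b⁻¹ ^ t`, the
  -- other makes the weighted series summable. Its terms then tend to zero almost surely, so
  -- eventually `b⁻¹ ^ t ≤ 2 ^ N`, and logarithms give the density.
  set b : ℝ := √(1 - p / 2) with hb
  have hb0 : 0 < b := Real.sqrt_pos.2 hr0
  have hb1 : b < 1 := by rw [hb, Real.sqrt_lt' one_pos]; simpa using hr1
  have hbb : b * b = 1 - p / 2 := Real.mul_self_sqrt hr0.le
  have hlog : 0 < Real.log b⁻¹ := Real.log_pos ((one_lt_inv₀ hb0).2 hb1)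
  have hlog2 : 0 < Real.log 2 := Real.log_pos one_lt_two
  refine ⟨Real.log b⁻¹ / Real.log 2, by positivity, ?_⟩
  have hr : (1 - ENNReal.ofReal p / 2 : ENNReal) = ENNReal.ofReal b * ENNReal.ofReal b := by
    rw [← ENNReal.ofReal_mul hb0.le, hbb, ENNReal.ofReal_sub _ (by positivity),
      ENNReal.ofReal_div_of_pos two_pos]
    simp
  have hcount := lintegral_half_pow_count_le hV hind hZ hA hp
  set s : ENNReal := ENNReal.ofReal b⁻¹
  have hbs : ENNReal.ofReal b * s = 1 := by
    rw [← ENNReal.ofReal_mul hb0.le, mul_inv_cancel₀ hb0.ne', ENNReal.ofReal_one]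
  have hmeas : ∀ t : ℕ, Measurable
      (fun ω => (2⁻¹ : ENNReal) ^ Nat.count (fun s => (Z s ω, V s ω) ∈ A) t * s ^ t) :=
    fun t => ((hcount t).1.mono (past_le hV t) le_rfl).mul_const _
  have hfin : ∫⁻ ω, ∑' t : ℕ,
      (2⁻¹ : ENNReal) ^ Nat.count (fun s => (Z s ω, V s ω) ∈ A) t * s ^ t ∂P ≠ ⊤ := by
    rw [lintegral_tsum fun t => (hmeas t).aemeasurable]
    refine ne_top_of_le_ne_top (b := ∑' t : ℕ, ENNReal.ofReal b ^ t) ?_ ?_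
    · rw [ENNReal.tsum_geometric]
      refine ENNReal.inv_ne_top.2 (tsub_pos_iff_lt.2 ?_).ne'
      rw [← ENNReal.ofReal_one]
      exact (ENNReal.ofReal_lt_ofReal_iff one_pos).2 hb1
    · refine ENNReal.tsum_le_tsum fun t => ?_
      rw [lintegral_mul_const _ ((hcount t).1.mono (past_le hV t) le_rfl)]
      calc _ ≤ (1 - ENNReal.ofReal p / 2) ^ t * s ^ t := by gcongr; exact (hcount t).2
        _ = ENNReal.ofReal b ^ t := by rw [hr, mul_pow, mul_assoc, ← mul_pow _ s, hbs]; simp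
  filter_upwards [ae_lt_top (Measurable.tsum hmeas) hfin] with ω hω
  have hlim := ENNReal.tendsto_atTop_zero_of_tsum_ne_top hω.ne
  filter_upwards [hlim.eventually_le_const one_pos] with t ht
  set N := Nat.count (fun s => (Z s ω, V s ω) ∈ A) t
  have hle : b⁻¹ ^ t ≤ 2 ^ N := by
    have h2 : s ^ t ≤ 2 ^ N := by
      calc s ^ t = 2 ^ N * ((2⁻¹ : ENNReal) ^ N * s ^ t) := by
            rw [← mul_assoc, ← mul_pow, ENNReal.mul_inv_cancel (by simp) (by simp)]; simp
        _ ≤ 2 ^ N * 1 := by gcongr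
        _ = 2 ^ N := mul_one _
    have h3 := ENNReal.toReal_mono (by finiteness) h2
    simpa [s, ENNReal.toReal_ofReal, hb0.le] using h3
  have := Real.log_le_log (by positivity) hle
  rw [Real.log_pow, Real.log_pow] at this
  rw [div_mul_eq_mul_div, div_le_iff₀ hlog2]
  linarith

end Counting

end SZGD

namespace SZGD

/-! ### Uniform frames and adaptedness of the iterates -/

/-- By invariance the probability depends on `z` only through `‖z‖`. Some squared coordinate of the
unit vector `v i` is at least `1/n`, so the equiprobable events for the `n` vectors `‖z‖ • e j`
cover almost everything. -/
theorem IsUniformStiefel.inv_le_measure_le_inner_sq {n k : ℕ}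
    {ν : Measure (Fin k → EuclideanSpace ℝ (Fin n))} (hν : IsUniformStiefel ν) (hn : 1 ≤ n)
    (i : Fin k) (z : EuclideanSpace ℝ (Fin n)) :
    ENNReal.ofReal (1 / n) ≤ ν {v | ‖z‖ ^ 2 ≤ n * inner ℝ (v i) z ^ 2} := by
  obtain ⟨hprob, hframe, hinv⟩ := hν
  have hn' : (0 : ℝ) < n := by exact_mod_cast hn
  let S : EuclideanSpace ℝ (Fin n) → Set (Fin k → EuclideanSpace ℝ (Fin n)) :=
    fun w => {v | ‖w‖ ^ 2 ≤ n * inner ℝ (v i) w ^ 2}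
  have hSm : ∀ w, MeasurableSet (S w) := fun w =>
    measurableSet_le measurable_const (by fun_prop)
  have hrot : ∀ w, ‖z‖ = ‖w‖ → ν (S w) = ν (S z) := by
    intro w hw
    -- The reflection exchanging two vectors of equal length.
    set U := ((ℝ ∙ (z - w))ᗮ).reflection
    have hU : U z = w := Submodule.reflection_sub hw
    have hUm : Measurable fun (v : Fin k → EuclideanSpace ℝ (Fin n)) i => U (v i) :=
      (continuous_pi fun i => U.continuous.comp (continuous_apply i)).measurable
    rw [← hinv U, Measure.map_apply hUm (hSm w), hinv U]
    congr 1
    ext v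
    simp only [S, Set.mem_preimage, Set.mem_ofPred_eq, ← hU, U.norm_map, U.inner_map_map]
  let e : Fin n → EuclideanSpace ℝ (Fin n) := fun j => EuclideanSpace.single j 1
  have hcover : ∀ᵐ v ∂ν, v ∈ ⋃ j, S (‖z‖ • e j) := by
    filter_upwards [hframe] with v hv
    by_contra hcon
    simp only [S, e, Set.mem_iUnion, Set.mem_ofPred_eq, not_exists, not_le, norm_smul, norm_norm,
      inner_smul_right, PiLp.norm_single, norm_one, mul_one, EuclideanSpace.inner_single_right,
      one_mul, conj_trivial] at hcon
    have hne : (Finset.univ : Finset (Fin n)).Nonempty := ⟨⟨0, hn⟩, Finset.mem_univ _⟩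
    have hlt := Finset.sum_lt_sum_of_nonempty hne fun j _ => hcon j
    have hnorm : ∑ j, (v i j) ^ 2 = 1 := by
      rw [← EuclideanSpace.real_norm_sq_eq, hv.1 i, one_pow]
    have hl : ∑ j, (n : ℝ) * (‖z‖ * v i j) ^ 2 = n * ‖z‖ ^ 2 := by
      simp_rw [mul_pow, ← Finset.mul_sum, hnorm, mul_one]
    rw [hl] at hlt
    simp at hlt
  have h1 : (1 : ENNReal) ≤ n * ν (S z) := by
    calc (1 : ENNReal) = ν Set.univ := measure_univ.symm
      _ ≤ ν (⋃ j, S (‖z‖ • e j)) := measure_mono_ae (hcover.mono fun v hv _ => hv)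
      _ ≤ ∑ j, ν (S (‖z‖ • e j)) := measure_iUnion_fintype_le ν _
      _ = n * ν (S z) := by
        rw [Finset.sum_congr rfl fun j _ => hrot (‖z‖ • e j) (by simp [e, norm_smul])]
        simp
  rw [ENNReal.ofReal_div_of_pos hn', ENNReal.ofReal_one, ENNReal.ofReal_natCast]
  exact ENNReal.div_le_of_le_mul' h1

theorem measurable_gradEst {n k : ℕ} {f : EuclideanSpace ℝ (Fin n) → ℝ} (hf : Continuous f)
    (δ : ℝ) : Measurable fun y : EuclideanSpace ℝ (Fin n) × (Fin k → EuclideanSpace ℝ (Fin n)) =>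
      gradEst f δ y.2 y.1 := by
  unfold gradEst
  exact Continuous.measurable (by fun_prop)

theorem measurable_past_iter {Ω : Type*} {n k : ℕ} {f : EuclideanSpace ℝ (Fin n) → ℝ}
    (hf : Continuous f) (η δ₀ : ℝ) (x₀ : EuclideanSpace ℝ (Fin n))
    (V : ℕ → Ω → Fin k → EuclideanSpace ℝ (Fin n)) (t : ℕ) :
    Measurable[past V t] fun ω => iter f η δ₀ x₀ (fun s => V s ω) t := by
  induction t with
  | zero => exact measurable_const
  | succ t ih =>
    have ih' := ih.mono (past_mono V (Nat.le_succ t)) le_rfl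
    have hg := (measurable_gradEst hf (δ₀ / 2 ^ t)).comp (ih'.prodMk (measurable_past_succ V t))
    exact ih'.sub (hg.const_smul η)

end SZGD

namespace SZGD

/-! ### One step of the descent -/

section Descent

variable {n : ℕ} {f : EuclideanSpace ℝ (Fin n) → ℝ} {L : ℝ}

theorem IsLSmooth.hasDerivAt_line (hf : IsLSmooth f L) (x d : EuclideanSpace ℝ (Fin n)) (s : ℝ) :
    HasDerivAt (fun s : ℝ => f (x + s • d)) (inner ℝ (gradient f (x + s • d)) d) s := by
  have hdiff : DifferentiableAt ℝ f (x + s • d) := (hf.1.differentiable one_ne_zero) _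
  have h := hdiff.hasGradientAt.hasFDerivAt
  have hline : HasDerivAt (fun s : ℝ => x + s • d) d s := by
    simpa using ((hasDerivAt_id s).smul_const d).const_add x
  have h' := h.comp_hasDerivAt s hline
  rwa [InnerProductSpace.toDual_apply_apply] at h'

/-- The descent lemma. -/
theorem IsLSmooth.le_add_inner_add_sq (hf : IsLSmooth f L) (x d : EuclideanSpace ℝ (Fin n)) :
    f (x + d) ≤ f x + inner ℝ (gradient f x) d + L / 2 * ‖d‖ ^ 2 := by
  set h : ℝ → ℝ := fun s => f (x + s • d) - s * inner ℝ (gradient f x) d - L / 2 * ‖d‖ ^ 2 * s ^ 2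
  have hd : ∀ s, HasDerivAt h (inner ℝ (gradient f (x + s • d)) d - inner ℝ (gradient f x) d
      - L / 2 * ‖d‖ ^ 2 * (2 * s)) s := by
    intro s
    have h2 := (hasDerivAt_id s).mul_const (inner ℝ (gradient f x) d)
    have h3 := (hasDerivAt_pow 2 s).const_mul (L / 2 * ‖d‖ ^ 2)
    refine (((hf.hasDerivAt_line x d s).sub h2).sub h3).congr_deriv ?_
    simp
  have hanti : AntitoneOn h (Set.Icc 0 1) := by
    refine antitoneOn_of_deriv_nonpos (convex_Icc 0 1)
      (fun s _ => (hd s).continuousAt.continuousWithinAt)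
      (fun s _ => (hd s).differentiableAt.differentiableWithinAt) fun s hs => ?_
    rw [interior_Icc] at hs
    rw [(hd s).deriv, ← inner_sub_left]
    have h1 := real_inner_le_norm (gradient f (x + s • d) - gradient f x) d
    have h2 := hf.2 (x + s • d) x
    rw [add_sub_cancel_left, norm_smul, Real.norm_of_nonneg hs.1.le] at h2
    have h3 := mul_le_mul_of_nonneg_right h2 (norm_nonneg d)
    linarith
  have := hanti (Set.left_mem_Icc.2 zero_le_one) (Set.right_mem_Icc.2 zero_le_one) zero_le_one
  simp only [h, one_smul, zero_smul, add_zero] at this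
  linarith

theorem IsLSmooth.gradient_neg (hf : IsLSmooth f L) (x : EuclideanSpace ℝ (Fin n)) :
    gradient (fun x => -f x) x = -gradient f x := by
  refine HasGradientAt.gradient ?_
  rw [hasGradientAt_iff_hasFDerivAt, map_neg]
  exact ((hf.1.differentiable one_ne_zero) x).hasGradientAt.hasFDerivAt.neg

theorem IsLSmooth.neg (hf : IsLSmooth f L) : IsLSmooth (fun x => -f x) L := by
  refine ⟨hf.1.neg, fun x y => ?_⟩
  rw [hf.gradient_neg, hf.gradient_neg, ← neg_sub', norm_neg]
  exact hf.2 x y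

theorem IsLSmooth.abs_sub_inner_le (hf : IsLSmooth f L) (x d : EuclideanSpace ℝ (Fin n)) :
    |f (x + d) - f x - inner ℝ (gradient f x) d| ≤ L / 2 * ‖d‖ ^ 2 := by
  have h1 := hf.le_add_inner_add_sq x d
  have h2 := hf.neg.le_add_inner_add_sq x d
  rw [hf.gradient_neg, inner_neg_left] at h2
  rw [abs_le]
  constructor <;> linarith

theorem IsLSmooth.abs_centralDiff_sub_inner_le (hf : IsLSmooth f L)
    (x : EuclideanSpace ℝ (Fin n)) {v : EuclideanSpace ℝ (Fin n)} (hv : ‖v‖ = 1) {δ : ℝ}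
    (hδ : 0 < δ) :
    |(f (x + δ • v) - f (x - δ • v)) / (2 * δ) - inner ℝ (gradient f x) v| ≤ L / 2 * δ := by
  have h1 := abs_le.1 (hf.abs_sub_inner_le x (δ • v))
  have h2 := abs_le.1 (hf.abs_sub_inner_le x (-(δ • v)))
  rw [norm_neg, ← sub_eq_add_neg, inner_neg_right] at h2
  rw [norm_smul, hv, inner_smul_right, Real.norm_of_nonneg hδ.le] at *
  have : (f (x + δ • v) - f (x - δ • v)) / (2 * δ) - inner ℝ (gradient f x) v =
      (f (x + δ • v) - f (x - δ • v) - 2 * δ * inner ℝ (gradient f x) v) / (2 * δ) := by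
    field_simp
  rw [this, abs_div, abs_of_pos (by positivity : 0 < 2 * δ), div_le_iff₀ (by positivity), abs_le]
  constructor <;> nlinarith [h1.1, h1.2, h2.1, h2.2]

theorem gradEst_eq {k : ℕ} (hk : 1 ≤ k) {δ : ℝ} (hδ : 0 < δ)
    (v : Fin k → EuclideanSpace ℝ (Fin n)) (x : EuclideanSpace ℝ (Fin n)) :
    gradEst f δ v x =
      ((n : ℝ) / k) • ∑ i, ((f (x + δ • v i) - f (x - δ • v i)) / (2 * δ)) • v i := by
  have hk' : (0 : ℝ) < k := by exact_mod_cast hk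
  simp only [gradEst, Finset.smul_sum, smul_smul]
  refine Finset.sum_congr rfl fun i _ => ?_
  congr 1
  field_simp

/-- Orthonormality diagonalises both the linear and the quadratic term of the descent lemma, so the
estimate reduces to one scalar inequality per column, between the true slope `a i` and the central
difference `b i`. These differ by `O(δ)`, which costs `O(δ²)` after Young's inequality. -/
theorem IsLSmooth.exists_descent_step {k : ℕ} (hk : 1 ≤ k) (hkn : k ≤ n) (hf : IsLSmooth f L)
    {η : ℝ} (hη : 0 < η) (hstep : L * n * η ^ 2 / (2 * k) - η < 0) (i₀ : Fin k) :
    ∃ c > 0, ∃ D > 0, ∀ v ∈ stiefel n k, ∀ δ > 0, ∀ x : EuclideanSpace ℝ (Fin n),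
      f (x - η • gradEst f δ v x) +
        c * (inner ℝ (v i₀) (gradient f x) ^ 2 + ‖η • gradEst f δ v x‖ ^ 2) ≤ f x + D * δ ^ 2 := by
  have hk' : (0 : ℝ) < k := by exact_mod_cast hk
  have hn' : (0 : ℝ) < n := by exact_mod_cast hk.trans hkn
  set c₀ := η - L * n * η ^ 2 / (2 * k) with hc₀
  have hc₀pos : 0 < c₀ := by linarith
  set r : ℝ := n / k with hr
  have hrpos : 0 < r := by positivity
  have hrel : L / 2 * (η ^ 2 * r) = η - c₀ := by rw [hc₀, hr]; field_simp; ring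
  set c : ℝ := min (r * (c₀ / 8)) (c₀ / (4 * (η ^ 2 * r))) with hc
  have hcpos : 0 < c := by positivity
  have hc1 : c ≤ r * (c₀ / 8) := min_le_left _ _
  have hc2 : c * (η ^ 2 * r) ≤ c₀ / 4 := by
    have : c ≤ c₀ / (4 * (η ^ 2 * r)) := min_le_right _ _
    calc c * (η ^ 2 * r) ≤ c₀ / (4 * (η ^ 2 * r)) * (η ^ 2 * r) := by gcongr
      _ = c₀ / 4 := by field_simp
  -- Budget for the available `c₀ * b i ^ 2`: a half goes to Young's inequality, a quarter to the
  -- step length and a quarter to `c₀ / 8 * a i ^ 2`; `e₀` collects the resulting multiples of `(b i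
  -- - a i) ^ 2`.
  set e₀ : ℝ := η ^ 2 / (2 * c₀) + c₀ / 4 with he₀
  -- The `+ 1` keeps the error constant positive even when `L = 0`.
  refine ⟨c, hcpos, n * e₀ * (L / 2) ^ 2 + 1, by positivity, fun v hv δ hδ x => ?_⟩
  have hv : Orthonormal ℝ v := hv
  set a : Fin k → ℝ := fun i => inner ℝ (gradient f x) (v i) with ha
  set b : Fin k → ℝ := fun i => (f (x + δ • v i) - f (x - δ • v i)) / (2 * δ) with hb
  have hab : ∀ i, (b i - a i) ^ 2 ≤ (L / 2 * δ) ^ 2 := fun i => by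
    rw [sq_le_sq, abs_of_nonneg (a := L / 2 * δ)]
    · exact hf.abs_centralDiff_sub_inner_le x (hv.1 i) hδ
    · exact (abs_nonneg _).trans (hf.abs_centralDiff_sub_inner_le x (hv.1 i) hδ)
  have hg := gradEst_eq (f := f) hk hδ v x
  have hinner : inner ℝ (gradient f x) (gradEst f δ v x) = r * ∑ i, a i * b i := by
    rw [hg, inner_smul_right, inner_sum]
    congr 1
    exact Finset.sum_congr rfl fun i _ => by rw [inner_smul_right, mul_comm]
  have hnorm : ‖gradEst f δ v x‖ ^ 2 = r ^ 2 * ∑ i, b i ^ 2 := by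
    rw [hg, norm_smul, mul_pow, Real.norm_of_nonneg hrpos.le, ← real_inner_self_eq_norm_sq,
      hv.inner_sum]
    simp [sq, hb]
  have hdesc := hf.le_add_inner_add_sq x (-(η • gradEst f δ v x))
  rw [← sub_eq_add_neg, inner_neg_right, norm_neg, inner_smul_right, hinner] at hdesc
  have hnorm2 : ‖η • gradEst f δ v x‖ ^ 2 = η ^ 2 * (r ^ 2 * ∑ i, b i ^ 2) := by
    rw [norm_smul, mul_pow, hnorm, Real.norm_of_nonneg hη.le]
  rw [hnorm2] at hdesc ⊢
  have hterm : ∀ i, -(η * (a i * b i)) + (η - c₀) * b i ^ 2 + c₀ / 4 * b i ^ 2 + c₀ / 8 * a i ^ 2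
      ≤ e₀ * (L / 2 * δ) ^ 2 := by
    intro i
    have h1 : e₀ * (b i - a i) ^ 2 ≤ e₀ * (L / 2 * δ) ^ 2 := by
      exact mul_le_mul_of_nonneg_left (hab i) (by positivity)
    have h2 : η * (b i - a i) * b i ≤ η ^ 2 / (2 * c₀) * (b i - a i) ^ 2 + c₀ / 2 * b i ^ 2 := by
      have : η ^ 2 / (2 * c₀) * (b i - a i) ^ 2 + c₀ / 2 * b i ^ 2 - η * (b i - a i) * b i =
          (η * (b i - a i) - c₀ * b i) ^ 2 / (2 * c₀) := by field_simp; ring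
      have : 0 ≤ (η * (b i - a i) - c₀ * b i) ^ 2 / (2 * c₀) := by positivity
      linarith
    have h3 : a i ^ 2 ≤ 2 * b i ^ 2 + 2 * (b i - a i) ^ 2 := by nlinarith [sq_nonneg (2 * b i - a i)]
    have h4 := mul_le_mul_of_nonneg_left h3 hc₀pos.le
    rw [he₀] at h1 ⊢
    linarith
  have hsum := Finset.sum_le_sum fun i (_ : i ∈ Finset.univ) => hterm i
  simp only [Finset.sum_add_distrib, Finset.sum_neg_distrib, ← Finset.mul_sum, Finset.sum_const,
    Finset.card_univ, Fintype.card_fin, nsmul_eq_mul] at hsum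
  have hsingle : inner ℝ (v i₀) (gradient f x) ^ 2 ≤ ∑ i, a i ^ 2 := by
    rw [real_inner_comm]
    exact Finset.single_le_sum (f := fun i => a i ^ 2) (fun i _ => sq_nonneg _)
      (Finset.mem_univ i₀)
  have hB : 0 ≤ ∑ i, b i ^ 2 := Finset.sum_nonneg fun i _ => sq_nonneg _
  have hA : 0 ≤ ∑ i, a i ^ 2 := Finset.sum_nonneg fun i _ => sq_nonneg _
  have h1 : c * inner ℝ (v i₀) (gradient f x) ^ 2 ≤ r * (c₀ / 8) * ∑ i, a i ^ 2 := by gcongr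
  have h2 : c * (η ^ 2 * (r ^ 2 * ∑ i, b i ^ 2)) ≤ r * (c₀ / 4) * ∑ i, b i ^ 2 := by
    calc c * (η ^ 2 * (r ^ 2 * ∑ i, b i ^ 2)) = r * (c * (η ^ 2 * r)) * ∑ i, b i ^ 2 := by ring
      _ ≤ _ := by gcongr
  have h3 : L / 2 * (η ^ 2 * (r ^ 2 * ∑ i, b i ^ 2)) = r * (η - c₀) * ∑ i, b i ^ 2 := by
    rw [← hrel]; ring
  have h4 := mul_le_mul_of_nonneg_left hsum hrpos.le
  have h5 : r * (e₀ * (k * (L / 2 * δ) ^ 2)) = n * e₀ * (L / 2) ^ 2 * δ ^ 2 := by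
    rw [hr]; field_simp
  rw [h5] at h4
  have h6 := sq_nonneg δ
  linarith

end Descent

end SZGD

namespace SZGD

/-! ### Deterministic convergence rates -/

/-- Near the limit set of a bounded sequence along which the gradient tends to zero, the
Łojasiewicz inequalities at the individual critical points combine into one, with a common
constant `K j`. -/
theorem exists_eventually_lojasiewicz {n : ℕ} {f : EuclideanSpace ℝ (Fin n) → ℝ}
    (hf : Continuous f) (hg : Continuous (gradient f)) {θ : ℝ} {K : ℕ → ℝ} (hK : Monotone K)
    (hloj : ∀ p, gradient f p = 0 → ∃ j, ∃ μ > 0, LojasiewiczIneq f θ (K j) μ p)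
    {x : ℕ → EuclideanSpace ℝ (Fin n)} (hb : Bornology.IsBounded (Set.range x)) {l : ℝ}
    (hl : Tendsto (fun t => f (x t)) atTop (𝓝 l)) {good : ℕ → Prop} {u : ℕ → ℝ}
    (hu : Tendsto u atTop (𝓝 0)) (hgood : ∀ t, good t → ‖gradient f (x t)‖ ^ 2 ≤ u t) :
    ∃ j, ∀ᶠ t in atTop, good t → |f (x t) - l| ^ θ ≤ K j * ‖gradient f (x t)‖ := by
  by_contra! hcon
  -- Diagonal choice: the time `φ j` violates the inequality with constant `K j`, so near a limit
  -- point `p` late violations contradict the fixed constant valid at `p`, `K` being monotone.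
  obtain ⟨φ, hφ, hφbad⟩ := extraction_forall_of_frequently hcon
  obtain ⟨p, -, ψ, hψ, hlim⟩ := tendsto_subseq_of_bounded (x := x ∘ φ) hb fun t => ⟨φ t, rfl⟩
  have hsub : Tendsto (fun i => φ (ψ i)) atTop atTop := hφ.tendsto_atTop.comp hψ.tendsto_atTop
  have hfp : f p = l := tendsto_nhds_unique ((hf.tendsto p).comp hlim) (hl.comp hsub)
  have hgp : gradient f p = 0 := by
    have h1 : Tendsto (fun i => ‖gradient f (x (φ (ψ i)))‖ ^ 2) atTop (𝓝 0) :=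
      squeeze_zero (fun _ => sq_nonneg _) (fun i => hgood _ (hφbad (ψ i)).1) (hu.comp hsub)
    have h2 := (((hg.tendsto p).comp hlim).norm.pow 2)
    have := tendsto_nhds_unique h2 h1
    simpa using this
  obtain ⟨j, μ, hμ, hj⟩ := hloj p hgp
  have hnear : ∀ᶠ i in atTop, ‖x (φ (ψ i)) - p‖ < μ := by
    have := (tendsto_iff_norm_sub_tendsto_zero.1 hlim).eventually_lt_const hμ
    simpa using this
  obtain ⟨i, hi, hji⟩ := (hnear.and (eventually_ge_atTop j)).exists
  have h1 := hj _ hi.le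
  rw [hfp] at h1
  have h2 := (hφbad (ψ i)).2
  have h3 : K j * ‖gradient f (x (φ (ψ i)))‖ ≤ K (ψ i) * ‖gradient f (x (φ (ψ i)))‖ := by
    gcongr
    exact hK (hji.trans hψ.le_apply)
  linarith

theorem rpow_max_le_sq_of_rpow_le {d θ m a : ℝ} (hd0 : 0 ≤ d) (hd : d ≤ 1) (hm : 2 * θ ≤ m)
    (hm0 : 0 < m) (h : d ^ θ ≤ a) : d ^ m ≤ a ^ 2 := by
  have h0 : 0 ≤ d ^ θ := Real.rpow_nonneg hd0 _
  rcases hd0.eq_or_lt with rfl | hpos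
  · rw [Real.zero_rpow hm0.ne']
    exact sq_nonneg _
  · calc d ^ m ≤ d ^ (2 * θ) := Real.rpow_le_rpow_of_exponent_ge hpos hd hm
      _ = (d ^ θ) ^ 2 := by rw [mul_comm, Real.rpow_mul hd0]; norm_cast
      _ ≤ a ^ 2 := by gcongr

/-- The larger of `d` and `E * w` is at least `G / 2`; in the second case `w ^ m ≤ w` because `w ≤ 1
≤ m`. The bound `c ≤ 1 / 2` later keeps the contraction factor `1 - c` positive. -/
theorem exists_mul_rpow_add_le {m A B E : ℝ} (hm : 1 ≤ m) (hA : 0 < A) (hB : 0 < B) (hE : 0 < E) :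
    ∃ c > 0, c ≤ 1 / 2 ∧ ∀ d w G, 0 ≤ d → 0 ≤ w → w ≤ 1 → 0 ≤ G → G ≤ d + E * w →
      c * G ^ m ≤ A * d ^ m + B * w := by
  have hm0 : 0 < m := by linarith
  set c := min (1 / 2) (min (A / 2 ^ m) (B / (2 * E) ^ m)) with hc
  have hcA : c * 2 ^ m ≤ A := by
    rw [← le_div_iff₀ (by positivity)]
    exact (min_le_right _ _).trans (min_le_left _ _)
  have hcB : c * (2 * E) ^ m ≤ B := by
    rw [← le_div_iff₀ (by positivity)]
    exact (min_le_right _ _).trans (min_le_right _ _)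
  have hcpos : 0 < c := by positivity
  refine ⟨c, hcpos, min_le_left _ _, fun d w G hd hw0 hw1 hG0 hG => ?_⟩
  have hdm : 0 ≤ d ^ m := Real.rpow_nonneg hd _
  rcases le_total (E * w) d with h | h
  · calc c * G ^ m ≤ c * (2 * d) ^ m := by gcongr; linarith
      _ = c * 2 ^ m * d ^ m := by rw [Real.mul_rpow two_pos.le hd]; ring
      _ ≤ A * d ^ m := by gcongr
      _ ≤ A * d ^ m + B * w := by linarith [mul_nonneg hB.le hw0]
  · have hwm : w ^ m ≤ w := by
      simpa using Real.rpow_le_rpow_of_exponent_ge_of_imp hw0 hw1 hm (by intro _ h; linarith)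
    calc c * G ^ m ≤ c * (2 * E * w) ^ m := by gcongr; linarith
      _ = c * (2 * E) ^ m * w ^ m := by rw [Real.mul_rpow (by positivity) hw0]; ring
      _ ≤ B * w := by gcongr
      _ ≤ A * d ^ m + B * w := by linarith [mul_nonneg hA.le hdm]

/-- A sequence that is nearly decreasing, up to geometrically small errors, converges, and a
corrected gap to its limit is a genuine Lyapunov function. -/
theorem exists_limit_of_almost_decreasing {φ q : ℕ → ℝ} {D δ₀ : ℝ} (hD : 0 < D)
    (hφ : BddBelow (Set.range φ)) (hq : ∀ t, 0 ≤ q t)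
    (hstep : ∀ t, φ (t + 1) + q t ≤ φ t + D * (δ₀ / 2 ^ t) ^ 2) :
    ∃ l, Tendsto φ atTop (𝓝 l) ∧ ∃ G : ℕ → ℝ, (∀ t, 0 ≤ G t) ∧ Tendsto G atTop (𝓝 0) ∧
      (∀ t, G t = φ t - l + 2 * D * (δ₀ / 2 ^ t) ^ 2) ∧
      ∀ t, G (t + 1) + q t + D / 2 * (δ₀ / 2 ^ t) ^ 2 ≤ G t := by
  -- Since `δ_t²` shrinks by a factor 4, the correction drops by `3D/2 * δ_t²`, covering the error
  -- `D * δ_t²` with `D/2 * δ_t²` to spare.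
  set F : ℕ → ℝ := fun t => φ t + 2 * D * (δ₀ / 2 ^ t) ^ 2 with hF
  have hδ : Tendsto (fun t : ℕ => 2 * D * (δ₀ / 2 ^ t) ^ 2) atTop (𝓝 0) := by
    have h1 : Tendsto (fun t : ℕ => δ₀ * (2⁻¹ : ℝ) ^ t) atTop (𝓝 (δ₀ * 0)) :=
      (tendsto_pow_atTop_nhds_zero_of_lt_one (by norm_num) (by norm_num)).const_mul _
    simpa [div_eq_mul_inv] using (h1.pow 2).const_mul (2 * D)
  have hFstep : ∀ t, F (t + 1) + q t + D / 2 * (δ₀ / 2 ^ t) ^ 2 ≤ F t := by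
    intro t
    have h1 := hstep t
    have h2 : (δ₀ / 2 ^ (t + 1)) ^ 2 = (δ₀ / 2 ^ t) ^ 2 / 4 := by rw [pow_succ]; field_simp; ring
    simp only [hF, h2]
    linarith
  have hanti : Antitone F := antitone_nat_of_succ_le fun t => by
    have := hFstep t
    have := hq t
    have : 0 ≤ D / 2 * (δ₀ / 2 ^ t) ^ 2 := by positivity
    linarith
  have hbdd : BddBelow (Set.range F) := by
    obtain ⟨M, hM⟩ := hφ
    refine ⟨M, ?_⟩
    rintro _ ⟨t, rfl⟩
    have h1 : M ≤ φ t := hM ⟨t, rfl⟩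
    have h2 : 0 ≤ 2 * D * (δ₀ / 2 ^ t) ^ 2 := by positivity
    simp only [hF]
    linarith
  have hlim := tendsto_atTop_ciInf hanti hbdd
  set l := ⨅ t, F t
  refine ⟨l, ?_, fun t => F t - l, fun t => sub_nonneg.2 (ciInf_le hbdd t), ?_, ?_, ?_⟩
  · simpa [hF] using hlim.sub hδ
  · simpa using hlim.sub_const l
  · intro t; simp only [hF]; ring
  · intro t; linarith [hFstep t]

theorem summable_and_tsum_le_of_lyapunov {G s : ℕ → ℝ} {c : ℝ} (hc : 0 < c) (hG : ∀ t, 0 ≤ G t)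
    (hs : ∀ t, 0 ≤ s t) (hstep : ∀ t, G (t + 1) + c * s t ≤ G t) :
    Summable s ∧ ∀ t, ∑' i, s (t + i) ≤ G t / c := by
  have hpart : ∀ t N, ∑ i ∈ Finset.range N, s (t + i) ≤ G t / c := by
    intro t N
    have : c * ∑ i ∈ Finset.range N, s (t + i) + G (t + N) ≤ G t := by
      induction N with
      | zero => simp
      | succ N ih =>
        have := hstep (t + N)
        rw [Finset.sum_range_succ, ← add_assoc t N 1]
        linarith
    rw [le_div_iff₀ hc]
    linarith [hG (t + N)]
  refine ⟨?_, fun t => Real.tsum_le_of_sum_range_le (fun i => hs _) (hpart t)⟩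
  exact summable_of_sum_range_le hs fun N => by simpa using hpart 0 N

open Classical in
/-- Geometric decay when a decreasing sequence contracts at a set of times of positive density. -/
theorem tendsto_pow_mul_of_contraction {G : ℕ → ℝ} (hG : ∀ t, 0 ≤ G t) (hanti : Antitone G)
    {good : ℕ → Prop} {c α : ℝ} (hc0 : 0 < c) (hc1 : c < 1) (hα : 0 < α)
    (hstep : ∀ᶠ t in atTop, good t → G (t + 1) ≤ (1 - c) * G t)
    (hcount : ∀ᶠ t : ℕ in atTop, α * t ≤ Nat.count good t) :
    Tendsto (fun t : ℕ => ((1 - c) ^ (-(α / 2))) ^ t * G t) atTop (𝓝 0) := by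
  set r := 1 - c with hr
  have hr0 : 0 < r := by linarith
  have hr1 : r < 1 := by linarith
  obtain ⟨T, hT⟩ := eventually_atTop.1 hstep
  have hmain : ∀ t ≥ T, G t * r ^ Nat.count good T ≤ r ^ Nat.count good t * G T := by
    intro t ht
    induction t, ht using Nat.le_induction with
    | base => rw [mul_comm]
    | succ t ht ih =>
      rw [Nat.count_succ]
      split_ifs with hgt
      · calc G (t + 1) * r ^ Nat.count good T ≤ r * G t * r ^ Nat.count good T := by
              gcongr; exact hT t ht hgt
          _ = r * (G t * r ^ Nat.count good T) := by ring
          _ ≤ r * (r ^ Nat.count good t * G T) := by gcongr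
          _ = r ^ (Nat.count good t + 1) * G T := by ring
      · refine le_trans ?_ ih
        gcongr
        exact hanti (Nat.le_succ t)
  set C := G T / r ^ Nat.count good T
  have hC : 0 ≤ C := div_nonneg (hG T) (by positivity)
  have hb0 : 0 < r ^ (α / 2) := Real.rpow_pos_of_pos hr0 _
  have hb1 : r ^ (α / 2) < 1 := Real.rpow_lt_one hr0.le hr1 (by positivity)
  have hlim : Tendsto (fun t : ℕ => (r ^ (α / 2)) ^ t * C) atTop (𝓝 0) := by
    simpa using (tendsto_pow_atTop_nhds_zero_of_lt_one hb0.le hb1).mul_const C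
  refine squeeze_zero' (Eventually.of_forall fun t => mul_nonneg (by positivity) (hG t)) ?_ hlim
  filter_upwards [hcount, eventually_ge_atTop T] with t hN ht
  have h1 : G t ≤ r ^ Nat.count good t * C := by
    rw [← mul_div_assoc, le_div_iff₀ (by positivity)]
    exact hmain t ht
  -- One half of the decay cancels the weight, the other half tends to zero.
  have h2 : r ^ Nat.count good t ≤ (r ^ (α / 2)) ^ t * (r ^ (α / 2)) ^ t := by
    calc r ^ Nat.count good t = r ^ (Nat.count good t : ℝ) := (Real.rpow_natCast _ _).symm
      _ ≤ r ^ (α * t) := Real.rpow_le_rpow_of_exponent_ge hr0 hr1.le hN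
      _ = _ := by
        rw [← mul_pow, ← Real.rpow_add hr0, add_halves, Real.rpow_mul hr0.le, Real.rpow_natCast]
  have h3 : (r ^ (-(α / 2))) ^ t * (r ^ (α / 2)) ^ t = 1 := by
    rw [← mul_pow, ← Real.rpow_add hr0]; simp
  calc (r ^ (-(α / 2))) ^ t * G t
      ≤ (r ^ (-(α / 2))) ^ t * ((r ^ (α / 2)) ^ t * (r ^ (α / 2)) ^ t * C) := by
        gcongr
        exact h1.trans (by gcongr)
    _ = ((r ^ (-(α / 2))) ^ t * (r ^ (α / 2)) ^ t) * ((r ^ (α / 2)) ^ t * C) := by ring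
    _ = (r ^ (α / 2)) ^ t * C := by rw [h3, one_mul]

/-- The discrete form of `x' = -c x ^ (1 + a)` implying `(x ^ (-a))' = a c`; two uses of `1 + u ≤
exp u` replace the integration. -/
theorem rpow_neg_add_le_of_le_sub {x y c a : ℝ} (hy : 0 < y) (hx : 0 < x) (ha : 0 < a)
    (h : y ≤ x - c * x ^ (1 + a)) : x ^ (-a) + a * c ≤ y ^ (-a) := by
  have hxa : x ^ (1 + a) = x * x ^ a := by rw [Real.rpow_add hx, Real.rpow_one]
  have hy' : y ≤ x * Real.exp (-(c * x ^ a)) := by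
    calc y ≤ x * (-(c * x ^ a) + 1) := by rw [hxa] at h; linarith
      _ ≤ _ := by gcongr; exact Real.add_one_le_exp _
  calc x ^ (-a) + a * c = x ^ (-a) * (a * (c * x ^ a) + 1) := by
        have : x ^ (-a) * x ^ a = 1 := by rw [← Real.rpow_add hx]; simp
        linear_combination (-(a * c)) * this
    _ ≤ x ^ (-a) * Real.exp (a * (c * x ^ a)) := by gcongr; exact Real.add_one_le_exp _
    _ = (x * Real.exp (-(c * x ^ a))) ^ (-a) := by
        rw [Real.mul_rpow hx.le (Real.exp_pos _).le, ← Real.exp_mul]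
        congr 2
        ring
    _ ≤ y ^ (-a) := Real.rpow_le_rpow_of_nonpos hy hy' (by linarith)

open Classical in
/-- Polynomial decay when a decreasing sequence satisfies `G (t + 1) ≤ G t - c * G t ^ (1 + a)` at
a set of times of positive density. -/
theorem isBigO_rpow_of_superlinear_decrease {G : ℕ → ℝ} (hG : ∀ t, 0 ≤ G t) (hanti : Antitone G)
    {good : ℕ → Prop} {c a α : ℝ} (hc : 0 < c) (ha : 0 < a) (hα : 0 < α)
    (hstep : ∀ᶠ t in atTop, good t → G (t + 1) ≤ G t - c * G t ^ (1 + a))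
    (hcount : ∀ᶠ t : ℕ in atTop, α * t ≤ Nat.count good t) :
    G =O[atTop] fun t : ℕ => (t : ℝ) ^ (-a⁻¹) := by
  by_cases hpos : ∀ t, 0 < G t
  swap
  · obtain ⟨t₀, ht₀⟩ := not_forall.1 hpos
    refine IsBigO.of_bound 0 ?_
    filter_upwards [eventually_ge_atTop t₀] with t ht
    rw [le_antisymm ((hanti ht).trans (not_lt.1 ht₀)) (hG t)]
    simp
  obtain ⟨T, hT⟩ := eventually_atTop.1 hstep
  have hmain : ∀ t ≥ T, a * c * Nat.count good t ≤ G t ^ (-a) + a * c * Nat.count good T := by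
    intro t ht
    induction t, ht using Nat.le_induction with
    | base => linarith [Real.rpow_nonneg (hG T) (-a)]
    | succ t ht ih =>
      rw [Nat.count_succ]
      split_ifs with hgt
      · have := rpow_neg_add_le_of_le_sub (hpos (t + 1)) (hpos t) ha (hT t ht hgt)
        push_cast
        linarith
      · have := Real.rpow_le_rpow_of_nonpos (hpos (t + 1)) (hanti (Nat.le_succ t))
          (by linarith : -a ≤ 0)
        push_cast
        linarith
  -- Half the linear growth absorbs the contribution of the times before `T`.
  set β := a * c * α / 2 with hβ
  have hβ0 : 0 < β := by positivity
  have hlarge : ∀ᶠ t : ℕ in atTop, a * c * Nat.count good T ≤ β * t :=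
    (tendsto_natCast_atTop_atTop.const_mul_atTop hβ0).eventually_ge_atTop _
  refine IsBigO.of_bound (β ^ (-a⁻¹)) ?_
  filter_upwards [hcount, hlarge, eventually_ge_atTop T, eventually_gt_atTop 0] with t hN hl ht ht0
  have ht0' : (0 : ℝ) < t := by exact_mod_cast ht0
  have h1 : β * t ≤ G t ^ (-a) := by
    have := mul_le_mul_of_nonneg_left hN (by positivity : 0 ≤ a * c)
    have := hmain t ht
    have h3 : a * c * (α * t) = β * t + β * t := by rw [hβ]; ring
    linarith
  rw [Real.norm_of_nonneg (hG t), Real.norm_of_nonneg (Real.rpow_nonneg ht0'.le _),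
    ← Real.mul_rpow hβ0.le ht0'.le]
  calc G t = (G t ^ (-a)) ^ (-a⁻¹) := by
        rw [← Real.rpow_mul (hG t), neg_mul_neg, mul_inv_cancel₀ ha.ne', Real.rpow_one]
    _ ≤ (β * t) ^ (-a⁻¹) :=
        Real.rpow_le_rpow_of_nonpos (by positivity) h1 (neg_nonpos.2 (inv_pos.2 ha).le)

end SZGD

namespace SZGD

/-! ### Rates along bounded paths -/

theorem IsLSmooth.continuous_gradient {n : ℕ} {f : EuclideanSpace ℝ (Fin n) → ℝ} {L : ℝ}
    (hf : IsLSmooth f L) : Continuous (gradient f) :=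
  (LipschitzWith.of_dist_le_mul (K := L.toNNReal) fun x y => by
    rw [dist_eq_norm, dist_eq_norm]
    exact (hf.2 x y).trans (by gcongr; exact Real.le_coe_toNNReal L)).continuous

/-- The frame `v` sees a fixed proportion of the gradient at `x` through its column `i`. -/
def IsInformative {n k : ℕ} (f : EuclideanSpace ℝ (Fin n) → ℝ) (i : Fin k)
    (x : EuclideanSpace ℝ (Fin n)) (v : Fin k → EuclideanSpace ℝ (Fin n)) : Prop :=
  ‖gradient f x‖ ^ 2 ≤ n * inner ℝ (v i) (gradient f x) ^ 2

/-- The whole deterministic analysis. `C` is chosen before the path, so a common `κ` yields a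
deterministic rate; the family `K` lets the constant depend on the path otherwise. -/
theorem exists_lyapunov_decrease {n k : ℕ} (hk : 1 ≤ k) (hkn : k ≤ n)
    {f : EuclideanSpace ℝ (Fin n) → ℝ} {L θ : ℝ} (hf : IsLSmooth f L)
    (hbelow : BddBelow (Set.range f)) {η δ₀ : ℝ} (hη : 0 < η) (hδ₀ : δ₀ ∈ Set.Ioc (0 : ℝ) 1)
    (hstep : L * n * η ^ 2 / (2 * k) - η < 0) (x₀ : EuclideanSpace ℝ (Fin n)) (i : Fin k) {m : ℝ}
    (hm : 1 ≤ m) (hθm : 2 * θ ≤ m) :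
    ∃ b > 0, ∃ C : ℝ → ℝ, (∀ κ > 0, 0 < C κ ∧ C κ ≤ 1 / 2) ∧
      ∀ (v : ℕ → Fin k → EuclideanSpace ℝ (Fin n)) (x : ℕ → EuclideanSpace ℝ (Fin n)),
        (∀ t, v t ∈ stiefel n k) → (∀ t, x t = iter f η δ₀ x₀ v t) →
        Bornology.IsBounded (Set.range x) →
        ∃ G : ℕ → ℝ, (∀ t, 0 ≤ G t) ∧ Antitone G ∧ Tendsto G atTop (𝓝 0) ∧
          Summable (sqStep x) ∧ (∀ t, tailSum x t ≤ b * G t) ∧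
          ∀ K : ℕ → ℝ, Monotone K → (∀ j, 0 < K j) →
            (∀ p, gradient f p = 0 → ∃ j, ∃ μ > 0, LojasiewiczIneq f θ (K j) μ p) →
            ∃ j, ∀ᶠ t in atTop, IsInformative f i (x t) (v t) →
              G (t + 1) ≤ G t - C (K j) * G t ^ m := by
  obtain ⟨c, hc, D, hD, hdesc⟩ := hf.exists_descent_step hk hkn hη hstep i
  have hn : (0 : ℝ) < n := by exact_mod_cast hk.trans hkn
  have hconst : ∀ κ > 0, ∃ C > 0, C ≤ 1 / 2 ∧ ∀ d w G : ℝ, 0 ≤ d → 0 ≤ w → w ≤ 1 → 0 ≤ G →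
      G ≤ d + 2 * D * w → C * G ^ m ≤ c / (n * κ ^ 2) * d ^ m + D / 2 * w := fun κ hκ =>
    exists_mul_rpow_add_le hm (by positivity) (by positivity) (by positivity)
  choose! C hC0 hC1 hC using hconst
  refine ⟨1 / c, by positivity, C, fun κ hκ => ⟨hC0 κ hκ, hC1 κ hκ⟩, fun v x hv hx hb => ?_⟩
  have hxs : ∀ t, x (t + 1) = x t - η • gradEst f (δ₀ / 2 ^ t) (v t) (x t) := fun t => by
    rw [hx, hx]; rfl
  have hδ : ∀ t : ℕ, 0 < δ₀ / 2 ^ t := fun t => div_pos hδ₀.1 (by positivity)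
  have hφ : ∀ t, f (x (t + 1)) + c * (inner ℝ (v t i) (gradient f (x t)) ^ 2 + sqStep x t) ≤
      f (x t) + D * (δ₀ / 2 ^ t) ^ 2 := by
    intro t
    have h := hdesc (v t) (hv t) _ (hδ t) (x t)
    have hs : sqStep x t = ‖η • gradEst f (δ₀ / 2 ^ t) (v t) (x t)‖ ^ 2 := by
      rw [sqStep, hxs, sub_sub_cancel_left, norm_neg]
    rwa [← hxs, ← hs] at h
  have hs0 : ∀ t, 0 ≤ sqStep x t := fun t => sq_nonneg _
  obtain ⟨l, hl, G, hG0, hGlim, hGeq, hGstep⟩ := exists_limit_of_almost_decreasing hD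
    (hbelow.mono (by rintro _ ⟨t, rfl⟩; exact ⟨x t, rfl⟩))
    (fun t => mul_nonneg hc.le (add_nonneg (sq_nonneg _) (hs0 t))) hφ
  have hanti : Antitone G := antitone_nat_of_succ_le fun t => by
    have h1 := hGstep t
    have h2 : 0 ≤ c * (inner ℝ (v t i) (gradient f (x t)) ^ 2 + sqStep x t) :=
      mul_nonneg hc.le (add_nonneg (sq_nonneg _) (hs0 t))
    have h3 : 0 ≤ D / 2 * (δ₀ / 2 ^ t) ^ 2 := by positivity
    linarith
  have hdrop : ∀ t, c * inner ℝ (v t i) (gradient f (x t)) ^ 2 + D / 2 * (δ₀ / 2 ^ t) ^ 2 ≤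
      G t - G (t + 1) := fun t => by linarith [hGstep t, mul_nonneg hc.le (hs0 t)]
  obtain ⟨hsum, htail⟩ := summable_and_tsum_le_of_lyapunov hc hG0 hs0 fun t => by
    have h1 := hGstep t
    have h2 : 0 ≤ c * inner ℝ (v t i) (gradient f (x t)) ^ 2 := by positivity
    have h3 : 0 ≤ D / 2 * (δ₀ / 2 ^ t) ^ 2 := by positivity
    linarith
  refine ⟨G, hG0, hanti, hGlim, hsum, fun t => ?_, fun K hK hK0 hloj => ?_⟩
  · rw [one_div_mul_eq_div]
    exact htail t
  -- At informative times `‖∇f‖²` is at most `n / c` times the drop of `G`, hence at most this null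
  -- sequence.
  have hu : Tendsto (fun t => n * (G t / c)) atTop (𝓝 0) := by
    simpa using (hGlim.div_const c).const_mul (n : ℝ)
  obtain ⟨j, hj⟩ := exists_eventually_lojasiewicz hf.1.continuous hf.continuous_gradient hK hloj hb
    hl (good := fun t => IsInformative f i (x t) (v t)) hu fun t ht => by
      refine le_trans ht ?_
      gcongr
      rw [le_div_iff₀ hc]
      have h3 : 0 ≤ D / 2 * (δ₀ / 2 ^ t) ^ 2 := by positivity
      linarith [hdrop t, hG0 (t + 1)]
  refine ⟨j, ?_⟩
  have hclose : ∀ᶠ t in atTop, |f (x t) - l| ≤ 1 := by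
    have h : Tendsto (fun t => |f (x t) - l|) atTop (𝓝 0) := by
      simpa using (hl.sub_const l).abs
    exact h.eventually_le_const one_pos
  filter_upwards [hj, hclose] with t ht ht1 hgood
  have hκ := hK0 j
  have hd := rpow_max_le_sq_of_rpow_le (abs_nonneg _) ht1 hθm (by linarith) (ht hgood)
  have hδ1 : (δ₀ / 2 ^ t) ^ 2 ≤ 1 := by
    refine pow_le_one₀ (hδ t).le ?_
    exact (div_le_self hδ₀.1.le (one_le_pow₀ one_le_two)).trans hδ₀.2
  have hCG := hC (K j) hκ |f (x t) - l| ((δ₀ / 2 ^ t) ^ 2) (G t) (abs_nonneg _) (sq_nonneg _) hδ1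
    (hG0 t) (by rw [hGeq t]; gcongr; exact le_abs_self _)
  have hgain : c / (n * K j ^ 2) * |f (x t) - l| ^ m ≤
      c * inner ℝ (v t i) (gradient f (x t)) ^ 2 := by
    calc c / (n * K j ^ 2) * |f (x t) - l| ^ m
        ≤ c / (n * K j ^ 2) * (K j * ‖gradient f (x t)‖) ^ 2 := by gcongr
      _ = c / n * ‖gradient f (x t)‖ ^ 2 := by field_simp
      _ ≤ c / n * (n * inner ℝ (v t i) (gradient f (x t)) ^ 2) := by gcongr; exact hgood
      _ = c * inner ℝ (v t i) (gradient f (x t)) ^ 2 := by field_simp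
  linarith [hdrop t]

/-- Rounding constants up puts them in one countable monotone family of positive numbers. -/
theorem IsLojasiewicz.exists_nat_add_one {n : ℕ} {f : EuclideanSpace ℝ (Fin n) → ℝ} {θ : ℝ}
    (h : IsLojasiewicz f θ) (p : EuclideanSpace ℝ (Fin n)) (hp : gradient f p = 0) :
    ∃ j : ℕ, ∃ μ > 0, LojasiewiczIneq f θ (j + 1) μ p := by
  obtain ⟨κ, -, μ, hμ, hineq⟩ := h.2 p hp
  obtain ⟨j, hj⟩ := exists_nat_ge κ
  exact ⟨j, μ, hμ, fun x hx => (hineq x hx).trans (by gcongr; linarith)⟩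

theorem tailSum_nonneg {n : ℕ} (x : ℕ → EuclideanSpace ℝ (Fin n)) (t : ℕ) : 0 ≤ tailSum x t :=
  tsum_nonneg fun _ => sq_nonneg _

theorem tendsto_pow_mul_tailSum {n : ℕ} {x : ℕ → EuclideanSpace ℝ (Fin n)} {G : ℕ → ℝ} {b Q : ℝ}
    (hQ : 0 ≤ Q) (htail : ∀ t, tailSum x t ≤ b * G t)
    (h : Tendsto (fun t : ℕ => Q ^ t * G t) atTop (𝓝 0)) :
    Tendsto (fun t : ℕ => Q ^ t * tailSum x t) atTop (𝓝 0) := by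
  refine squeeze_zero (fun t => mul_nonneg (by positivity) (tailSum_nonneg x t)) (fun t => ?_)
    (by simpa using h.const_mul b)
  calc Q ^ t * tailSum x t ≤ Q ^ t * (b * G t) := by gcongr; exact htail t
    _ = b * (Q ^ t * G t) := by ring

open Classical in
theorem exists_ae_eventually_mul_le_count_isInformative {Ω : Type*} [MeasurableSpace Ω]
    {P : Measure Ω} [IsProbabilityMeasure P] {n k : ℕ} (hn : 1 ≤ n)
    {f : EuclideanSpace ℝ (Fin n) → ℝ} {L : ℝ} (hf : IsLSmooth f L) (η δ₀ : ℝ)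
    (x₀ : EuclideanSpace ℝ (Fin n)) {V : ℕ → Ω → Fin k → EuclideanSpace ℝ (Fin n)}
    (hVmeas : ∀ t, Measurable (V t)) (hVindep : iIndepFun V P)
    (hVunif : ∀ t, IsUniformStiefel (P.map (V t))) (i : Fin k) :
    ∃ α > (0 : ℝ), ∀ᵐ ω ∂P, ∀ᶠ t : ℕ in atTop, α * t ≤
      Nat.count (fun s => IsInformative f i (iter f η δ₀ x₀ (fun s => V s ω) s) (V s ω)) t := by
  have hn' : (1 : ℝ) ≤ n := by exact_mod_cast hn
  have hgc := hf.continuous_gradient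
  exact exists_ae_eventually_mul_le_count hVmeas hVindep
    (measurable_past_iter hf.1.continuous η δ₀ x₀ V)
    (A := {y : EuclideanSpace ℝ (Fin n) × (Fin k → EuclideanSpace ℝ (Fin n)) |
      IsInformative f i y.1 y.2})
    (IsClosed.measurableSet (isClosed_le (by fun_prop) (by fun_prop)))
    (p := 1 / n) (by positivity) (by rw [div_le_one (by linarith)]; exact hn')
    fun t z => (hVunif t).inv_le_measure_le_inner_sq hn i (gradient f z)

end SZGD

/-! ### Almost sure rates in the two exponent regimes -/

theorem theorem4 {Ω : Type*} [MeasurableSpace Ω] (P : Measure Ω) [IsProbabilityMeasure P]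
    (n k : ℕ) (hk : 1 ≤ k) (hkn : k ≤ n)
    (f : EuclideanSpace ℝ (Fin n) → ℝ) (L θ : ℝ) (hL : 0 < L) (hθ : θ ∈ Set.Ioo (0 : ℝ) 1)
    (hsmooth : SZGD.IsLSmooth f L) (hloj : SZGD.IsLojasiewicz f θ)
    (hbelow : BddBelow (Set.range f))
    (η δ₀ : ℝ) (hη : 0 < η) (hδ₀ : δ₀ ∈ Set.Ioc (0 : ℝ) 1)
    (x₀ : EuclideanSpace ℝ (Fin n))
    (V : ℕ → Ω → Fin k → EuclideanSpace ℝ (Fin n))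
    (hVmeas : ∀ t, Measurable (V t)) (hVindep : iIndepFun V P)
    (hVunif : ∀ t, SZGD.IsUniformStiefel (P.map (V t)))
    (X : ℕ → Ω → EuclideanSpace ℝ (Fin n))
    (hX : ∀ t ω, X t ω = SZGD.iter f η δ₀ x₀ (fun s => V s ω) t)
    (hbdd : ∀ᵐ ω ∂P, Bornology.IsBounded (Set.range fun t => X t ω)) :
    (θ ≤ 1 / 2 → -1 ≤ L * n * η ^ 2 / (2 * k) - η → L * n * η ^ 2 / (2 * k) - η < 0 →
      (∀ κ > 0, SZGD.IsLojasiewiczWith f θ κ →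
        ∃ Q > (1 : ℝ), ∀ᵐ ω ∂P, Summable (SZGD.sqStep fun t => X t ω) ∧
          Tendsto (fun t : ℕ => Q ^ t * SZGD.tailSum (fun s => X s ω) t) atTop (𝓝 0)) ∧
      (∀ᵐ ω ∂P, Summable (SZGD.sqStep fun t => X t ω) ∧
        ∃ Q > (1 : ℝ),
          Tendsto (fun t : ℕ => Q ^ t * SZGD.tailSum (fun s => X s ω) t) atTop (𝓝 0))) ∧
    (1 / 2 < θ → η < 2 * k / (L * n) →
      ∀ᵐ ω ∂P, Summable (SZGD.sqStep fun t => X t ω) ∧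
        Tendsto (SZGD.tailSum fun s => X s ω) atTop (𝓝 0) ∧
        (SZGD.tailSum fun s => X s ω) =O[atTop] fun t : ℕ => (t : ℝ) ^ (1 / (1 - 2 * θ))) := by
  classical
  have hn : 1 ≤ n := hk.trans hkn
  have hk' : (0 : ℝ) < k := by exact_mod_cast hk
  have hn' : (0 : ℝ) < n := by exact_mod_cast hn
  let i : Fin k := ⟨0, hk⟩
  have hframes : ∀ᵐ ω ∂P, ∀ t, V t ω ∈ SZGD.stiefel n k :=
    ae_all_iff.2 fun t => ae_of_ae_map (hVmeas t).aemeasurable (hVunif t).2.1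
  obtain ⟨α, hα, hcount⟩ := SZGD.exists_ae_eventually_mul_le_count_isInformative hn hsmooth η δ₀ x₀
    hVmeas hVindep hVunif i
  simp_rw [← hX] at hcount
  have hmono : Monotone fun j : ℕ => (j : ℝ) + 1 := fun a b h => by
    have : (a : ℝ) ≤ b := by exact_mod_cast h
    simpa using this
  constructor
  · intro hθ2 _ hstep
    obtain ⟨b, hb, C, hC, hpath⟩ := SZGD.exists_lyapunov_decrease hk hkn hsmooth hbelow hη hδ₀
      hstep x₀ i le_rfl (by linarith : 2 * θ ≤ 1)
    simp only [Real.rpow_one, ← one_sub_mul] at hpath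
    have hQ : ∀ κ > 0, 1 < (1 - C κ) ^ (-(α / 2)) := fun κ hκ =>
      Real.one_lt_rpow_of_pos_of_lt_one_of_neg (by linarith [hC κ hκ]) (by linarith [hC κ hκ])
        (by linarith)
    constructor
    · intro κ hκ hlojκ
      refine ⟨_, hQ κ hκ, ?_⟩
      filter_upwards [hframes, hbdd, hcount] with ω hv hbd hN
      obtain ⟨G, hG0, hanti, -, hsum, htail, hrate⟩ :=
        hpath (fun s => V s ω) (fun t => X t ω) hv (fun t => hX t ω) hbd
      -- With a constant family the index found along the path is irrelevant, so `Q` does not depend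
      -- on `ω`.
      obtain ⟨-, hj⟩ := hrate (fun _ => κ) monotone_const (fun _ => hκ)
        fun p hp => ⟨0, hlojκ.2 p hp⟩
      exact ⟨hsum, SZGD.tendsto_pow_mul_tailSum (by linarith [hQ κ hκ]) htail
        (SZGD.tendsto_pow_mul_of_contraction hG0 hanti (hC κ hκ).1 (by linarith [(hC κ hκ).2]) hα
          hj hN)⟩
    · filter_upwards [hframes, hbdd, hcount] with ω hv hbd hN
      obtain ⟨G, hG0, hanti, -, hsum, htail, hrate⟩ :=
        hpath (fun s => V s ω) (fun t => X t ω) hv (fun t => hX t ω) hbd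
      obtain ⟨j, hj⟩ := hrate (fun j => j + 1) hmono (fun j => by positivity)
        hloj.exists_nat_add_one
      have hκ : (0 : ℝ) < j + 1 := by positivity
      exact ⟨hsum, _, hQ _ hκ, SZGD.tendsto_pow_mul_tailSum (by linarith [hQ _ hκ]) htail
        (SZGD.tendsto_pow_mul_of_contraction hG0 hanti (hC _ hκ).1 (by linarith [(hC _ hκ).2]) hα
          hj hN)⟩
  · intro hθ2 hηlt
    have hstep : L * n * η ^ 2 / (2 * k) - η < 0 := by
      rw [lt_div_iff₀ (by positivity)] at hηlt
      rw [sub_neg, div_lt_iff₀ (by positivity)]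
      calc L * n * η ^ 2 = η * (η * (L * n)) := by ring
        _ < η * (2 * k) := by gcongr
    -- The exponent `2θ` is written as `1 + a` with `a = 2θ - 1`, giving decay of order `t ^
    -- (-a⁻¹)`.
    obtain ⟨b, hb, C, hC, hpath⟩ := SZGD.exists_lyapunov_decrease hk hkn hsmooth hbelow hη hδ₀
      hstep x₀ i (by linarith : 1 ≤ 1 + (2 * θ - 1)) (by linarith : 2 * θ ≤ 1 + (2 * θ - 1))
    filter_upwards [hframes, hbdd, hcount] with ω hv hbd hN
    obtain ⟨G, hG0, hanti, hGlim, hsum, htail, hrate⟩ :=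
      hpath (fun s => V s ω) (fun t => X t ω) hv (fun t => hX t ω) hbd
    obtain ⟨j, hj⟩ := hrate (fun j => j + 1) hmono (fun j => by positivity)
      hloj.exists_nat_add_one
    have hκ : (0 : ℝ) < j + 1 := by positivity
    have hexp : 1 / (1 - 2 * θ) = -(2 * θ - 1)⁻¹ := by
      rw [one_div, ← neg_sub, inv_neg]
    have hO := SZGD.isBigO_rpow_of_superlinear_decrease hG0 hanti (hC _ hκ).1
      (by linarith : 0 < 2 * θ - 1) hα hj hN
    rw [hexp]
    refine ⟨hsum, ?_, IsBigO.trans (IsBigO.of_bound b ?_) hO⟩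
    · exact squeeze_zero (SZGD.tailSum_nonneg _) htail (by simpa using hGlim.const_mul b)
    · refine Eventually.of_forall fun t => ?_
      rw [Real.norm_of_nonneg (SZGD.tailSum_nonneg _ t), Real.norm_of_nonneg (hG0 t)]
      exact htail t
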